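/- Let $\alpha>0$, let $N\ge 0$ be an integer, and let $a_{2k+1},b_{2k+1}\in\mathbb R$ $(0\le k\le N)$ with $a_{2N+1}\neq 0$ or $b_{2N+1}\neq 0$. Put $$p(\theta)=\frac{\alpha}{2}+\sum_{k=0}^{N}\bigl(a_{2k+1}\cos((2k+1)\theta)+b_{2k+1}\sin((2k+1)\theta)\bigr)$$ and suppose that $p(\theta)+p''(\theta)\ge 0$ for all $\theta\in\mathbb R$. Let $\mathcal C\subset\mathbb R^2$ be the corresponding algebraic curve of constant width $\alpha$, that is, the image of $$\theta\in[-\pi,\pi]\longmapsto \bigl(p(\theta)\cos\theta-p'(\theta)\sin\theta,\; p(\theta)\sin\theta+p'(\theta)\cos\theta\bigr),$$ and suppose that $\mathcal C$ is not a circle. Then $\mathcal C$ has a defining polynomial, that is, an irreducible $f\in\mathbb R[x,y]$ that generates the ideal of all real polynomials vanishing on $\mathcal C$ (so $f$ is unique up to a nonzero constant factor), and every such $f$ has total degree $4N+4$ and partial degrees $\deg_x f=\deg_y f=4N+4$. -/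

import Mathlib

noncomputable section

namespace ConstantWidth

/-- The trigonometric polynomial
`p(θ) = α/2 + ∑_{k=0}^{N} (a_{2k+1} cos((2k+1)θ) + b_{2k+1} sin((2k+1)θ))`.
Only the values of `a` and `b` at odd indices up to `2N+1` are used. -/
def oddSupport (α : ℝ) (N : ℕ) (a b : ℕ → ℝ) (θ : ℝ) : ℝ :=
  α / 2 + ∑ k ∈ Finset.range (N + 1),
    (a (2 * k + 1) * Real.cos (((2 * k + 1 : ℕ) : ℝ) * θ) +
      b (2 * k + 1) * Real.sin (((2 * k + 1 : ℕ) : ℝ) * θ))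

/-- The parametrization `γ(θ) = (p cos θ - p' sin θ, p sin θ + p' cos θ)`. -/
def param (p : ℝ → ℝ) (θ : ℝ) : Fin 2 → ℝ :=
  ![p θ * Real.cos θ - deriv p θ * Real.sin θ,
    p θ * Real.sin θ + deriv p θ * Real.cos θ]

/-- The planar curve traced by `γ` on `[-π, π]`. -/
def curve (p : ℝ → ℝ) : Set (Fin 2 → ℝ) :=
  param p '' Set.Icc (-Real.pi) Real.pi

/-- The convexity condition `p + p'' ≥ 0`. -/
def ConvexitySupport (p : ℝ → ℝ) : Prop :=
  ∀ θ : ℝ, 0 ≤ p θ + deriv (deriv p) θ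

/-- `C` is the algebraic curve of constant width `α` with the coefficients `a`, `b` up to
order `2N+1`. -/
structure IsConstantWidthCurve (C : Set (Fin 2 → ℝ)) (α : ℝ) (N : ℕ) (a b : ℕ → ℝ) :
    Prop where
  width_pos : 0 < α
  eq_curve : C = curve (oddSupport α N a b)
  convexity : ConvexitySupport (oddSupport α N a b)

/-- `C` is a Euclidean circle of positive radius. -/
def IsCircle (C : Set (Fin 2 → ℝ)) : Prop :=
  ∃ (c : Fin 2 → ℝ) (r : ℝ), 0 < r ∧
    C = {q | (q 0 - c 0) ^ 2 + (q 1 - c 1) ^ 2 = r ^ 2}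

/-- `f` is a defining polynomial of `C`: it is irreducible and generates the ideal of all real
polynomials that vanish on `C`. -/
def IsDefiningPolynomial (f : MvPolynomial (Fin 2) ℝ) (C : Set (Fin 2 → ℝ)) : Prop :=
  Irreducible f ∧ MvPolynomial.vanishingIdeal ℝ C = Ideal.span {f}

end ConstantWidth

end

/-!
With `z = exp (I * θ)`, the coordinates of the curve are Laurent polynomials in `z`, with exponents
from `-(2N+2)` to `2N+2`, and the ideal of the curve is the kernel of the substitution of these
Laurent polynomials `x`, `y` for the variables. This kernel is a nonzero nonmaximal prime of
`ℝ[x, y]`, hence generated by an irreducible `f`.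

* Upper bound: a polynomial of degree `d` restricted to the curve becomes a trigonometric polynomial
  with at most `(4N+4)d + 1` coefficients, and comparing dimensions as `d → ∞` gives
  `deg f ≤ 4N+4`.
* Lower bound: `ℂ(z)` has degree `4N+4` over `ℂ(x)` and over `ℂ(y)`, so it suffices that the
  parametrization is birational, i.e. `ℂ(x, y) = ℂ(z)`. The index of `ℂ(x, y)` divides `4N+4` and
  also `4N+2`, the degree of `w = x + I * y`, whose exponents range from `-2N` only to `2N+2`. So it
  divides `2` and the extension is Galois. An automorphism of `ℂ(z)` fixing `w` must permute the
  poles `0`, `∞` of `w`; it cannot exchange them, whose orders differ, and it is not a nontrivial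
  dilation, because the coefficient of `z` in `w` is nonzero.
-/

namespace ConstantWidth

open Polynomial IntermediateField

section RationalFunctions

variable {K : Type*} [Field K]

/-- The rational function `P / X ^ m`, which encodes a Laurent polynomial. -/
noncomputable def laurentFrac (P : K[X]) (m : ℕ) : RatFunc K :=
  algebraMap K[X] (RatFunc K) P / RatFunc.X ^ m

theorem finrank_adjoin_div_of_isCoprime {p q : K[X]} (hq : q ≠ 0) (h : IsCoprime p q) :
    Module.finrank K⟮(algebraMap K[X] (RatFunc K) p / algebraMap K[X] (RatFunc K) q)⟯ (RatFunc K) =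
      max p.natDegree q.natDegree := by
  set f := algebraMap K[X] (RatFunc K) p / algebraMap K[X] (RatFunc K) q with hf
  have hcross : f.num * q = p * f.denom := (RatFunc.num_mul_eq_mul_denom_iff hq).2 hf
  have hdenom : Associated f.denom q := associated_of_dvd_dvd (RatFunc.denom_div_dvd p q)
    (h.symm.dvd_of_dvd_mul_left (Dvd.intro_left _ hcross))
  have hnum : Associated f.num p := associated_of_dvd_dvd (RatFunc.num_div_dvd p hq)
    (h.dvd_of_dvd_mul_right (Dvd.intro _ hcross.symm))
  rw [RatFunc.finrank_eq_max_natDegree,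
    natDegree_eq_of_degree_eq (degree_eq_degree_of_associated hdenom),
    natDegree_eq_of_degree_eq (degree_eq_degree_of_associated hnum)]

theorem finrank_adjoin_laurentFrac {P : K[X]} {m : ℕ} (h0 : P.coeff 0 ≠ 0)
    (hm : m ≤ P.natDegree) :
    Module.finrank K⟮laurentFrac P m⟯ (RatFunc K) = P.natDegree := by
  have hcop : IsCoprime P (X ^ m) :=
    (prime_X.irreducible.coprime_iff_not_dvd.2 fun h => h0 (X_dvd_iff.1 h)).symm.pow_right
  have := finrank_adjoin_div_of_isCoprime (pow_ne_zero m X_ne_zero) hcop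
  rwa [map_pow, RatFunc.algebraMap_X, natDegree_X_pow, max_eq_left hm] at this

theorem transcendental_of_finrank_adjoin_ne_zero {r : RatFunc K}
    (hr : Module.finrank K⟮r⟯ (RatFunc K) ≠ 0) : Transcendental K r := by
  refine RatFunc.transcendental_of_ne_C r ?_
  rintro ⟨c, rfl⟩
  simp [RatFunc.finrank_eq_max_natDegree] at hr

theorem algHom_algebraMap_eq_aeval {A : Type*} [CommRing A] [Algebra K A]
    (σ : RatFunc K →ₐ[K] A) (p : K[X]) :
    σ (algebraMap K[X] (RatFunc K) p) = aeval (σ RatFunc.X) p := by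
  rw [← RatFunc.aeval_X_left_eq_algebraMap, aeval_algHom_apply]

theorem algHom_eq_id_of_apply_X {σ : RatFunc K →ₐ[K] RatFunc K} (h : σ RatFunc.X = RatFunc.X) :
    σ = AlgHom.id K (RatFunc K) := by
  ext f
  rw [← RatFunc.num_div_denom f, map_div₀, algHom_algebraMap_eq_aeval, algHom_algebraMap_eq_aeval,
    h, RatFunc.aeval_X_left_eq_algebraMap, RatFunc.aeval_X_left_eq_algebraMap, AlgHom.id_apply]

theorem exists_eq_C_mul_X_pow_of_dvd {p : K[X]} {m : ℕ} (h : p ∣ X ^ m) :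
    ∃ (c : K) (i : ℕ), p = C c * X ^ i := by
  obtain ⟨i, -, hi⟩ := (dvd_prime_pow prime_X m).1 h
  obtain ⟨u, hu⟩ := hi.symm
  obtain ⟨c, -, hc⟩ := Polynomial.isUnit_iff.1 u.isUnit
  exact ⟨c, i, by rw [hc, mul_comm, hu]⟩

-- The rational root theorem: `r` is a root of `X ^ m * P(T) - P(X) * T ^ m`, whose extreme
-- coefficients in `T` are constants times `X ^ m`.
theorem eq_C_mul_zpow_of_aeval_mul_eq {P : K[X]} {m : ℕ} (hm : 0 < m) (hmP : m < P.natDegree)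
    (h0 : P.coeff 0 ≠ 0) {r : RatFunc K}
    (hr : aeval r P * RatFunc.X ^ m = algebraMap K[X] (RatFunc K) P * r ^ m) :
    ∃ (c : K) (k : ℤ), r = RatFunc.C c * RatFunc.X ^ k := by
  have hP : P ≠ 0 := by rintro rfl; simp at h0
  let Q : K[X][X] := C (X ^ m) * P.map C - C P * X ^ m
  have hroot : aeval r Q = 0 := by
    have hmap : aeval r (P.map (C : K →+* K[X])) = aeval r P := by
      rw [← Polynomial.algebraMap_eq, aeval_map_algebraMap]
    simp only [Q, map_sub, map_mul, aeval_C, map_pow, aeval_X, hmap, RatFunc.algebraMap_X]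
    rw [mul_comm, hr, sub_self]
  have hlead : Q.leadingCoeff = X ^ m * C P.leadingCoeff := by
    rw [leadingCoeff_sub_of_degree_lt, leadingCoeff_mul, leadingCoeff_C,
      leadingCoeff_map_of_injective C_injective]
    rw [degree_mul, degree_mul, degree_C (pow_ne_zero _ X_ne_zero), zero_add, degree_C hP,
      zero_add, degree_X_pow, degree_map_eq_of_injective C_injective, degree_eq_natDegree hP]
    exact_mod_cast hmP
  have hconst : Q.coeff 0 = X ^ m * C (P.coeff 0) := by
    simp only [Q, coeff_sub, coeff_C_mul, coeff_map, coeff_X_pow, hm.ne, if_false, mul_zero,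
      sub_zero]
  have hden := den_dvd_of_is_root (A := K[X]) hroot
  have hnum := num_dvd_of_is_root (A := K[X]) hroot
  rw [hlead, (isUnit_C.2 (leadingCoeff_ne_zero.2 hP).isUnit).dvd_mul_right] at hden
  rw [hconst, (isUnit_C.2 h0.isUnit).dvd_mul_right] at hnum
  obtain ⟨s, i, hs⟩ := exists_eq_C_mul_X_pow_of_dvd hnum
  obtain ⟨t, j, ht⟩ := exists_eq_C_mul_X_pow_of_dvd hden
  refine ⟨s / t, i - j, ?_⟩
  rw [← IsFractionRing.mk'_num_den' K[X] r, hs, ht, zpow_sub₀ RatFunc.X_ne_zero]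
  simp only [map_mul, map_pow, RatFunc.algebraMap_X, RatFunc.algebraMap_C, zpow_natCast, map_div₀]
  rw [div_mul_div_comm]

theorem eq_one_of_comp_mul_eq {P : K[X]} {m n : ℕ} {c : K} (hdeg : m < P.natDegree)
    (h1 : P.coeff (m + 1) ≠ 0) (hc : c ≠ 0)
    (h : P.comp (C c * X ^ n) * X ^ m = P * (C c * X ^ n) ^ m) : n = 1 ∧ c = 1 := by
  have hP : P ≠ 0 := by rintro rfl; simp at h1
  have hs : (C c * X ^ n : K[X]) ≠ 0 := mul_ne_zero (C_ne_zero.2 hc) (pow_ne_zero _ X_ne_zero)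
  have hcomp : P.comp (C c * X ^ n) ≠ 0 := by
    intro h'
    rw [h', zero_mul] at h
    exact mul_ne_zero hP (pow_ne_zero _ hs) h.symm
  have hn : n = 1 := by
    have hd := congrArg natDegree h
    rw [natDegree_mul hcomp (pow_ne_zero _ X_ne_zero), natDegree_mul hP (pow_ne_zero _ hs),
      natDegree_comp, natDegree_C_mul_X_pow _ _ hc, natDegree_X_pow, natDegree_pow,
      natDegree_C_mul_X_pow _ _ hc] at hd
    obtain ⟨d, hd'⟩ := Nat.exists_eq_add_of_lt hdeg
    rw [hd'] at hd
    exact Nat.eq_of_mul_eq_mul_left d.succ_pos (by linarith)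
  subst hn
  refine ⟨rfl, ?_⟩
  have hco := congrArg (coeff · (m + 1 + m)) h
  simp only [pow_one, mul_pow, ← C_pow] at hco
  rw [coeff_mul_X_pow, ← mul_assoc, coeff_mul_X_pow, comp_C_mul_X_coeff, coeff_mul_C] at hco
  have hpow : c ^ (m + 1) = c ^ m := mul_left_cancel₀ h1 hco
  rw [pow_succ] at hpow
  exact (mul_eq_left₀ (pow_ne_zero m hc)).1 hpow

theorem reverse_comp_mul_ne {P s : K[X]} {m e : ℕ} (hP : P ≠ 0) (hs : X ∣ s) (hm : m < e) :
    P.reverse.comp s * X ^ m ≠ P * s ^ e := by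
  intro h
  have hdvd : X ^ (m + 1) ∣ P.reverse.comp s * X ^ m := by
    rw [h]
    exact ((pow_dvd_pow X hm).trans (pow_dvd_pow_of_dvd hs e)).mul_left P
  rw [pow_succ', mul_dvd_mul_iff_right (pow_ne_zero m X_ne_zero), X_dvd_iff,
    coeff_zero_eq_eval_zero, eval_comp, ← coeff_zero_eq_eval_zero s, X_dvd_iff.1 hs,
    ← coeff_zero_eq_eval_zero, coeff_zero_reverse] at hdvd
  exact hP (leadingCoeff_eq_zero.1 hdvd)

theorem reverse_comp_mul_eq_of_aeval_inv {P s : K[X]} {m e : ℕ} (hs : s ≠ 0)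
    (hdeg : P.natDegree = m + e)
    (h : aeval (algebraMap K[X] (RatFunc K) s)⁻¹ P * RatFunc.X ^ m =
      algebraMap K[X] (RatFunc K) P * (algebraMap K[X] (RatFunc K) s)⁻¹ ^ m) :
    P.reverse.comp s * X ^ m = P * s ^ e := by
  have hs' : algebraMap K[X] (RatFunc K) s ≠ 0 := RatFunc.algebraMap_ne_zero hs
  let _ : Invertible (algebraMap K[X] (RatFunc K) s)⁻¹ := invertibleOfNonzero (inv_ne_zero hs')
  have hrev := eval₂_reverse_mul_pow (algebraMap K (RatFunc K)) (algebraMap K[X] (RatFunc K) s)⁻¹ P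
  rw [invOf_eq_inv, inv_inv, ← aeval_def, ← aeval_def, aeval_algebraMap_apply, hdeg] at hrev
  apply RatFunc.algebraMap_injective K
  simp only [map_mul, map_pow, RatFunc.algebraMap_X, comp_eq_aeval]
  rw [← hrev, inv_pow, inv_pow, mul_right_comm] at h
  have h' := (mul_inv_eq_iff_eq_mul₀ (pow_ne_zero _ hs')).1 h
  rw [pow_add, ← mul_assoc, inv_mul_cancel_right₀ (pow_ne_zero _ hs')] at h'
  exact h'

theorem eq_X_of_aeval_mul_eq {P : K[X]} {m : ℕ} (hm : 0 < m) (hdeg : 2 * m < P.natDegree)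
    (h0 : P.coeff 0 ≠ 0) (h1 : P.coeff (m + 1) ≠ 0) {r : RatFunc K}
    (hr : aeval r P * RatFunc.X ^ m = algebraMap K[X] (RatFunc K) P * r ^ m) :
    r = RatFunc.X := by
  have hP : P ≠ 0 := by rintro rfl; simp at h0
  obtain ⟨c, k, rfl⟩ := eq_C_mul_zpow_of_aeval_mul_eq hm (by omega) h0 hr
  have hc : c ≠ 0 := by
    rintro rfl
    simp [hm.ne', aeval_def, eval₂_at_zero, h0, RatFunc.X_ne_zero] at hr
  obtain ⟨n, rfl | ⟨hn, rfl⟩⟩ : ∃ n : ℕ, k = n ∨ 0 < n ∧ k = -n := by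
    obtain ⟨n, rfl | rfl⟩ := k.eq_nat_or_neg
    · exact ⟨n, .inl rfl⟩
    · rcases n.eq_zero_or_pos with rfl | hn
      · exact ⟨0, .inl rfl⟩
      · exact ⟨n, .inr ⟨hn, rfl⟩⟩
  · have hpoly : RatFunc.C c * RatFunc.X ^ (n : ℤ) = algebraMap K[X] (RatFunc K) (C c * X ^ n) := by
      simp
    rw [hpoly, aeval_algebraMap_apply, ← RatFunc.algebraMap_X, ← map_pow, ← map_pow, ← map_mul,
      ← map_mul, ← comp_eq_aeval] at hr
    obtain ⟨rfl, rfl⟩ := eq_one_of_comp_mul_eq (by omega) h1 hc (RatFunc.algebraMap_injective K hr)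
    simp
  · have hinv : RatFunc.C c * RatFunc.X ^ (-n : ℤ) =
        (algebraMap K[X] (RatFunc K) (C c⁻¹ * X ^ n))⁻¹ := by
      simp only [map_mul, map_pow, map_inv₀, RatFunc.algebraMap_C, RatFunc.algebraMap_X, mul_inv,
        inv_inv, zpow_neg, zpow_natCast]
    rw [hinv] at hr
    have hs : (C c⁻¹ * X ^ n : K[X]) ≠ 0 :=
      mul_ne_zero (C_ne_zero.2 (inv_ne_zero hc)) (pow_ne_zero _ X_ne_zero)
    exact absurd (reverse_comp_mul_eq_of_aeval_inv hs
        (Nat.add_sub_of_le (show m ≤ P.natDegree by omega)).symm hr)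
      (reverse_comp_mul_ne hP ((dvd_pow_self X hn.ne').mul_left _) (by omega))

theorem algHom_eq_id_of_apply_laurentFrac {P : K[X]} {m : ℕ} (hm : 0 < m)
    (hdeg : 2 * m < P.natDegree) (h0 : P.coeff 0 ≠ 0) (h1 : P.coeff (m + 1) ≠ 0)
    {σ : RatFunc K →ₐ[K] RatFunc K} (hσ : σ (laurentFrac P m) = laurentFrac P m) :
    σ = AlgHom.id K (RatFunc K) := by
  have hσX : σ RatFunc.X ≠ 0 := (map_ne_zero σ).2 RatFunc.X_ne_zero
  rw [laurentFrac, map_div₀, map_pow, algHom_algebraMap_eq_aeval,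
    div_eq_div_iff (pow_ne_zero _ hσX) (pow_ne_zero _ RatFunc.X_ne_zero)] at hσ
  exact algHom_eq_id_of_apply_X (eq_X_of_aeval_mul_eq hm hdeg h0 h1 hσ)

theorem eq_top_of_isGalois_of_laurentFrac_mem {P : K[X]} {m : ℕ} (hm : 0 < m)
    (hdeg : 2 * m < P.natDegree) (h0 : P.coeff 0 ≠ 0) (h1 : P.coeff (m + 1) ≠ 0)
    (E : IntermediateField K (RatFunc K)) [IsGalois E (RatFunc K)] (hE : laurentFrac P m ∈ E) :
    E = ⊤ := by
  refine eq_top_iff.2 fun f _ => ?_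
  have hfix : f ∈ (⊥ : IntermediateField E (RatFunc K)) :=
    (InfiniteGalois.mem_bot_iff_fixed f).2 fun σ =>
      DFunLike.congr_fun (algHom_eq_id_of_apply_laurentFrac (σ := σ.toAlgHom.restrictScalars K)
        hm hdeg h0 h1 (σ.commutes ⟨_, hE⟩)) f
  obtain ⟨g, rfl⟩ := IntermediateField.mem_bot.1 hfix
  exact g.2

theorem isGalois_of_finrank_dvd_two {F L : Type*} [Field F] [Field L] [Algebra F L] [CharZero F]
    (h : Module.finrank F L ∣ 2) : IsGalois F L := by
  rcases (Nat.dvd_prime Nat.prime_two).1 h with h | h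
  · exact isGalois_iff_isGalois_top.1
      (IntermediateField.bot_eq_top_iff_finrank_eq_one.2 h ▸ inferInstance)
  · have : Algebra.IsQuadraticExtension F L := ⟨h⟩
    have : FiniteDimensional F L := FiniteDimensional.of_finrank_pos (by omega)
    infer_instance

end RationalFunctions

section DegreeBound

variable {F E L : Type*} [CommRing F] [Field E] [CommRing L] [Algebra F E] [Algebra E L]
  [Algebra F L] [IsScalarTower F E L]

theorem aeval_map_aeval_optionEquivLeft {ι : Type*} (y : ι → E) (t : L)
    (p : MvPolynomial (Option ι) F) :
    aeval t ((MvPolynomial.optionEquivLeft F ι p).map (MvPolynomial.aeval y).toRingHom) =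
      MvPolynomial.aeval (fun o => o.elim t fun j => algebraMap E L (y j)) p := by
  induction p using MvPolynomial.induction_on with
  | C c => simp [IsScalarTower.algebraMap_apply F E L]
  | add p q hp hq => rw [map_add, map_add, Polynomial.map_add, map_add, hp, hq]
  | mul_X p o hp =>
    rw [map_mul, map_mul, Polynomial.map_mul, map_mul, hp]
    cases o <;> simp

theorem natDegree_minpoly_le_degreeOf {ι : Type*} {x : ι → L} {i : ι} {y : {j // j ≠ i} → E}
    (hxy : ∀ j, algebraMap E L (y j) = x j) (hy : AlgebraicIndependent F y)
    {f : MvPolynomial ι F} (hf : f ≠ 0) (h : MvPolynomial.aeval x f = 0) :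
    (minpoly E (x i)).natDegree ≤ f.degreeOf i := by
  classical
  let q := MvPolynomial.rename (Equiv.optionSubtypeNe i).symm f
  let g : E[X] := (MvPolynomial.optionEquivLeft F _ q).map (MvPolynomial.aeval y).toRingHom
  have hg : g ≠ 0 := by
    refine (Polynomial.map_ne_zero_iff hy).2 ((map_ne_zero_iff _ (AlgEquiv.injective _)).2 ?_)
    exact (map_ne_zero_iff _ (MvPolynomial.rename_injective _ (Equiv.injective _))).2 hf
  have hroot : aeval (x i) g = 0 := by
    rw [aeval_map_aeval_optionEquivLeft, MvPolynomial.aeval_rename, ← h]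
    congr 2
    funext j
    by_cases hj : j = i
    · subst hj
      simp
    · simp [hj, hxy]
  calc (minpoly E (x i)).natDegree
      ≤ g.natDegree := natDegree_le_natDegree (minpoly.degree_le_of_ne_zero _ _ hg hroot)
    _ ≤ (MvPolynomial.optionEquivLeft F _ q).natDegree := natDegree_map_le
    _ = f.degreeOf i := (MvPolynomial.degreeOf_eq_natDegree i f).symm

end DegreeBound

theorem finrank_adjoin_le_degreeOf {F K L : Type*} [CommRing F] [Field K] [Field L]
    [Algebra F K] [Algebra K L] [Algebra F L] [IsScalarTower F K L] {x : Fin 2 → L}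
    (htop : adjoin K (Set.range x) = ⊤) {i j : Fin 2} (hij : i ≠ j) (hx : Transcendental F (x j))
    [FiniteDimensional K⟮x j⟯ L] {f : MvPolynomial (Fin 2) F} (hf : f ≠ 0)
    (h : MvPolynomial.aeval x f = 0) : Module.finrank K⟮x j⟯ L ≤ f.degreeOf i := by
  have hcover : ∀ l, l = i ∨ l = j := by omega
  have hadj : (K⟮x j⟯)⟮x i⟯ = ⊤ := by
    rw [← restrictScalars_eq_top_iff (K := K), adjoin_simple_adjoin_simple, eq_top_iff, ← htop]
    refine adjoin.mono _ _ _ ?_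
    rintro _ ⟨l, rfl⟩
    rcases hcover l with rfl | rfl <;> simp
  have huniq : ∀ l : {l // l ≠ i}, l = ⟨j, hij.symm⟩ := fun l =>
    Subtype.ext ((hcover l).resolve_left l.2)
  let y : {l // l ≠ i} → K⟮x j⟯ := fun _ => AdjoinSimple.gen K (x j)
  have hxy : ∀ l, algebraMap K⟮x j⟯ L (y l) = x l := fun l => by
    rw [huniq l]
    exact AdjoinSimple.algebraMap_gen K (x j)
  have : IsScalarTower F K⟮x j⟯ L := .of_algebraMap_eq fun c => by
    rw [IsScalarTower.algebraMap_apply F K K⟮x j⟯, ← IsScalarTower.algebraMap_apply K K⟮x j⟯ L,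
      ← IsScalarTower.algebraMap_apply F K L]
  have : Unique {l // l ≠ i} := ⟨⟨⟨j, hij.symm⟩⟩, huniq⟩
  have hy : AlgebraicIndependent F y :=
    algebraicIndependent_unique_type_iff.2 <|
      (transcendental_algebraMap_iff (a := AdjoinSimple.gen K (x j))
        (algebraMap K⟮x j⟯ L).injective).1 (by rwa [AdjoinSimple.algebraMap_gen])
  calc Module.finrank K⟮x j⟯ L
      = Module.finrank K⟮x j⟯ (K⟮x j⟯)⟮x i⟯ := by rw [hadj, finrank_top']
    _ = (minpoly K⟮x j⟯ (x i)).natDegree := adjoin.finrank (.of_finite _ (x i))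
    _ ≤ f.degreeOf i := natDegree_minpoly_le_degreeOf hxy hy hf h

theorem height_eq_one_of_ringKrullDim_le_two {R : Type*} [CommRing R] [IsDomain R]
    [IsNoetherianRing R] (hR : ringKrullDim R ≤ 2) {I : Ideal R} [hI : I.IsPrime] (hbot : I ≠ ⊥)
    (hmax : ¬ I.IsMaximal) : I.height = 1 := by
  obtain ⟨J, hJ, hIJ⟩ := I.exists_le_maximal hI.ne_top
  have hJprime := hJ.isPrime
  have hlt : I < J := hIJ.lt_of_ne fun h => hmax (h ▸ hJ)
  have hJ2 : J.height ≤ 1 + 1 := by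
    have : (J.height : WithBot ℕ∞) ≤ (2 : ℕ∞) := Ideal.height_le_ringKrullDim_of_isPrime.trans hR
    exact WithBot.coe_le_coe.1 this
  have hbotprime : (⊥ : Ideal R).IsPrime := Ideal.isPrime_bot
  have hpos : 0 < I.height :=
    pos_of_gt (Ideal.height_strict_mono_of_isPrime (bot_lt_iff_ne_bot.2 hbot))
  have hlt2 : I.height + 1 ≤ 1 + 1 :=
    (Order.add_one_le_of_lt (Ideal.height_strict_mono_of_isPrime hlt)).trans hJ2
  exact le_antisymm ((ENat.add_le_add_iff_right ENat.one_ne_top).1 hlt2)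
    (Order.one_le_iff_pos.2 hpos)

theorem exists_irreducible_eq_span_singleton {R : Type*} [CommRing R] [IsDomain R]
    [UniqueFactorizationMonoid R] [IsNoetherianRing R]
    (hR : ringKrullDim R ≤ 2) {I : Ideal R} [hI : I.IsPrime] (hbot : I ≠ ⊥) (hmax : ¬ I.IsMaximal) :
    ∃ f, Irreducible f ∧ I = Ideal.span {f} := by
  obtain ⟨f, rfl⟩ := UniqueFactorizationMonoid.isPrincipal_of_height_eq_one
    (height_eq_one_of_ringKrullDim_le_two hR hbot hmax)
  have hf : f ≠ 0 := fun h => hbot (by simp [h])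
  exact ⟨f, ((Ideal.span_singleton_prime hf).1 hI).irreducible, rfl⟩

theorem not_isMaximal_ker_aeval {σ K L : Type*} [Finite σ] [Field K] [CommRing L] [Algebra K L]
    {x : σ → L} {i : σ} (hx : Transcendental K (x i)) :
    ¬ (RingHom.ker (MvPolynomial.aeval (R := K) x)).IsMaximal := by
  intro hmax
  let _ : Field (MvPolynomial σ K ⧸ RingHom.ker (MvPolynomial.aeval (R := K) x)) :=
    Ideal.Quotient.field _
  have hfin : Module.Finite K (MvPolynomial σ K ⧸ RingHom.ker (MvPolynomial.aeval (R := K) x)) :=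
    finite_of_finite_type_of_isJacobsonRing _ _
  have hint := (IsIntegral.of_finite K
    (Ideal.Quotient.mk (RingHom.ker (MvPolynomial.aeval (R := K) x)) (MvPolynomial.X i))).map
    (Ideal.kerLiftAlg (MvPolynomial.aeval (R := K) x))
  rw [Ideal.kerLiftAlg_mk, MvPolynomial.aeval_X] at hint
  exact hx hint.isAlgebraic

theorem finrank_restrictTotalDegree {σ K : Type*} [Fintype σ] [CommRing K] [Nontrivial K] (D : ℕ) :
    Module.finrank K (MvPolynomial.restrictTotalDegree σ K D) =
      (D + Fintype.card σ).choose (Fintype.card σ) := by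
  classical
  let s : Finset (σ →₀ ℕ) :=
    (Finset.range (D + 1)).biUnion fun k => Finset.finsuppAntidiag Finset.univ k
  have hs : {n : σ →₀ ℕ | (n.sum fun _ e => e) ≤ D} = s := by
    ext n
    simp [s, Finset.mem_finsuppAntidiag, Finsupp.sum_fintype]
  have hdisj : (Finset.range (D + 1) : Set ℕ).PairwiseDisjoint
      fun k => Finset.finsuppAntidiag (Finset.univ : Finset σ) k := by
    refine fun k _ l _ hkl => Finset.disjoint_left.2 fun n hk hl => hkl ?_
    rw [← (Finset.mem_finsuppAntidiag.1 hk).1, (Finset.mem_finsuppAntidiag.1 hl).1]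
  rw [MvPolynomial.restrictTotalDegree,
    Module.finrank_eq_nat_card_basis (MvPolynomial.basisRestrictSupport K _), hs,
    Nat.card_coe_set_eq, Set.ncard_coe_finset, Finset.card_biUnion hdisj,
    ← Nat.sum_range_multichoose]
  simp only [Finset.card_finsuppAntidiag_nat_eq_multichoose, Finset.card_univ]

theorem two_mul_finrank_restrictTotalDegree_fin_two (K : Type*) [CommRing K] [Nontrivial K]
    (D : ℕ) :
    2 * Module.finrank K (MvPolynomial.restrictTotalDegree (Fin 2) K D) = (D + 1) * (D + 2) := by
  rw [finrank_restrictTotalDegree, Fintype.card_fin]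
  have := Nat.add_one_mul_choose_eq (D + 1) 1
  rw [Nat.choose_one_right] at this
  linarith

section HomogenizedAeval

variable {ι R B : Type*} [CommSemiring R] [CommSemiring B] [Algebra R B]

/-- The value `g (P / Q) * Q ^ D`, written without denominators; it is meaningful when `g` has
total degree at most `D`. -/
noncomputable def homogenizedAeval (P : ι → B) (Q : B) (D : ℕ) (g : MvPolynomial ι R) : B :=
  ∑ d ∈ g.support, algebraMap R B (g.coeff d) * (d.prod fun i e => P i ^ e) * Q ^ (D - d.degree)

theorem map_homogenizedAeval {A : Type*} [Semifield A] [Algebra R A] (φ : B →ₐ[R] A) {P : ι → B}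
    {Q : B} {D : ℕ} {g : MvPolynomial ι R} (hg : g.totalDegree ≤ D) (hQ : φ Q ≠ 0) :
    φ (homogenizedAeval P Q D g) =
      MvPolynomial.aeval (fun i => φ (P i) / φ Q) g * φ Q ^ D := by
  rw [MvPolynomial.aeval_def, MvPolynomial.eval₂_eq, homogenizedAeval, map_sum, Finset.sum_mul]
  refine Finset.sum_congr rfl fun d hd => ?_
  have hdD : d.degree ≤ D := (MvPolynomial.le_totalDegree hd).trans hg
  have hsplit : φ Q ^ D = φ Q ^ d.degree * φ Q ^ (D - d.degree) := by
    rw [← pow_add, Nat.add_sub_of_le hdD]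
  simp only [Finsupp.prod, div_pow, Finset.prod_div_distrib, Finset.prod_pow_eq_pow_sum, map_mul,
    map_prod, map_pow, AlgHom.commutes, hsplit, ← Finsupp.degree_apply]
  rw [← mul_assoc, mul_assoc _ (_ / _), div_mul_cancel₀ _ (pow_ne_zero _ hQ)]

theorem natDegree_homogenizedAeval_le {S : Type*} [CommSemiring S] [Algebra R S] {P : ι → S[X]}
    {Q : S[X]} {n D : ℕ} (hP : ∀ i, (P i).natDegree ≤ n) (hQ : Q.natDegree ≤ n)
    {g : MvPolynomial ι R} (hg : g.totalDegree ≤ D) :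
    (homogenizedAeval P Q D g).natDegree ≤ n * D := by
  refine natDegree_sum_le_of_forall_le _ _ fun d hd => ?_
  have hdD : d.degree ≤ D := (MvPolynomial.le_totalDegree hd).trans hg
  have hprod : (d.prod fun i e => P i ^ e).natDegree ≤ d.degree * n :=
    calc _ ≤ ∑ i ∈ d.support, (P i ^ d i).natDegree := natDegree_prod_le _ _
      _ ≤ ∑ i ∈ d.support, d i * n :=
          Finset.sum_le_sum fun i _ => natDegree_pow_le_of_le _ (hP i)
      _ = d.degree * n := (Finset.sum_mul _ _ _).symm
  calc _ ≤ 0 + d.degree * n + (D - d.degree) * n :=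
        natDegree_mul_le_of_le (natDegree_mul_le_of_le (natDegree_C _).le hprod)
          (natDegree_pow_le_of_le _ hQ)
    _ = n * D := by rw [zero_add, ← add_mul, Nat.add_sub_of_le hdD, mul_comm]

end HomogenizedAeval

theorem algebraMap_homogenizedAeval {ι : Type*} (P : ι → ℂ[X]) (M : ℕ) {D : ℕ}
    {g : MvPolynomial ι ℝ} (hg : g.totalDegree ≤ D) :
    algebraMap ℂ[X] (RatFunc ℂ) (homogenizedAeval P (X ^ M) D g) =
      MvPolynomial.aeval (fun i => laurentFrac (P i) M) g * (RatFunc.X ^ M) ^ D := by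
  simpa [laurentFrac] using map_homogenizedAeval (IsScalarTower.toAlgHom ℝ ℂ[X] (RatFunc ℂ))
    (P := P) (Q := X ^ M) hg (by simp [RatFunc.X_ne_zero])

theorem exists_finset_subset_Ioc_card_eq (n : ℕ) :
    ∃ S : Finset ℝ, (S : Set ℝ) ⊆ Set.Ioc (-Real.pi) Real.pi ∧ S.card = n :=
  (Set.Ioc_infinite (by linarith [Real.pi_pos])).exists_subset_card_eq n

/-- The curve `γ` is parametrized by the Laurent polynomials `P i / X ^ M`, of degrees between `-M`
and `M`, at the points of the unit circle. -/
structure IsLaurentParam {ι : Type*} (γ : ℝ → ι → ℝ) (P : ι → ℂ[X]) (M : ℕ) : Prop where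
  natDegree_le : ∀ i, (P i).natDegree ≤ 2 * M
  eval_eq : ∀ i (θ : ℝ), (P i).eval (Circle.exp θ : ℂ) = γ θ i * (Circle.exp θ : ℂ) ^ M

namespace IsLaurentParam

variable {ι : Type*} {γ : ℝ → ι → ℝ} {P : ι → ℂ[X]} {M : ℕ}

theorem eval_homogenizedAeval (h : IsLaurentParam γ P M) {D : ℕ} {g : MvPolynomial ι ℝ}
    (hg : g.totalDegree ≤ D) (θ : ℝ) :
    (homogenizedAeval P (X ^ M) D g).eval (Circle.exp θ : ℂ) =
      (MvPolynomial.aeval (γ θ) g : ℝ) * ((Circle.exp θ : ℂ) ^ M) ^ D := by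
  have hexp : (Circle.exp θ : ℂ) ^ M ≠ 0 := pow_ne_zero _ (Circle.coe_ne_zero _)
  have := map_homogenizedAeval ((aeval (Circle.exp θ : ℂ)).restrictScalars ℝ) (P := P)
    (Q := X ^ M) hg (by simp)
  simp only [AlgHom.restrictScalars_apply, coe_aeval_eq_eval, eval_pow, eval_X, h.eval_eq,
    mul_div_cancel_right₀ _ hexp] at this
  rw [this, ← Complex.coe_algebraMap, ← MvPolynomial.aeval_algebraMap_apply]
  rfl

theorem aeval_eq_zero (h : IsLaurentParam γ P M) {g : MvPolynomial ι ℝ}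
    (hg : MvPolynomial.aeval (fun i => laurentFrac (P i) M) g = 0) (θ : ℝ) :
    MvPolynomial.aeval (γ θ) g = 0 := by
  have hzero : homogenizedAeval P (X ^ M) g.totalDegree g = 0 := by
    apply RatFunc.algebraMap_injective ℂ
    rw [algebraMap_homogenizedAeval P M le_rfl, hg, zero_mul, map_zero]
  have heval := h.eval_homogenizedAeval (le_refl g.totalDegree) θ
  rw [hzero, eval_zero] at heval
  exact_mod_cast (mul_eq_zero.1 heval.symm).resolve_right
    (pow_ne_zero _ (pow_ne_zero _ (Circle.coe_ne_zero _)))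

theorem aeval_laurentFrac_eq_zero (h : IsLaurentParam γ P M) {D : ℕ} {g : MvPolynomial ι ℝ}
    (hg : g.totalDegree ≤ D) {S : Finset ℝ} (hS : (S : Set ℝ) ⊆ Set.Ioc (-Real.pi) Real.pi)
    (hcard : 2 * M * D < S.card) (hzero : ∀ θ ∈ S, MvPolynomial.aeval (γ θ) g = 0) :
    MvPolynomial.aeval (fun i => laurentFrac (P i) M) g = 0 := by
  have hinj : Set.InjOn (fun θ => (Circle.exp θ : ℂ)) S :=
    Circle.coe_injective.comp_injOn ((Circle.exp_injOn_Ioc (by linarith)).mono hS)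
  have hpoly : homogenizedAeval P (X ^ M) D g = 0 := by
    refine eq_zero_of_natDegree_lt_card_of_eval_eq_zero' _ (S.image fun θ => (Circle.exp θ : ℂ))
      ?_ ?_
    · intro z hz
      obtain ⟨θ, hθ, rfl⟩ := Finset.mem_image.1 hz
      rw [h.eval_homogenizedAeval hg, hzero θ hθ, Complex.ofReal_zero, zero_mul]
    · rw [Finset.card_image_of_injOn hinj]
      refine (natDegree_homogenizedAeval_le h.natDegree_le ?_ hg).trans_lt hcard
      rw [natDegree_X_pow]
      omega
  have hfrac := algebraMap_homogenizedAeval P M hg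
  rw [hpoly, map_zero] at hfrac
  exact (mul_eq_zero.1 hfrac.symm).resolve_right
    (pow_ne_zero _ (pow_ne_zero _ RatFunc.X_ne_zero))

theorem vanishingIdeal_eq_ker (h : IsLaurentParam γ P M) :
    MvPolynomial.vanishingIdeal ℝ (γ '' Set.Icc (-Real.pi) Real.pi) =
      RingHom.ker (MvPolynomial.aeval (R := ℝ) fun i => laurentFrac (P i) M) := by
  ext g
  rw [MvPolynomial.mem_vanishingIdeal_iff, RingHom.mem_ker]
  refine ⟨fun hg => ?_, ?_⟩
  · obtain ⟨S, hS, hcard⟩ := exists_finset_subset_Ioc_card_eq (2 * M * g.totalDegree + 1)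
    exact h.aeval_laurentFrac_eq_zero le_rfl hS (by omega) fun θ hθ =>
      hg _ ⟨θ, Set.Ioc_subset_Icc_self (hS hθ), rfl⟩
  · rintro hg _ ⟨θ, -, rfl⟩
    exact h.aeval_eq_zero hg θ

theorem finrank_restrictTotalDegree_le [Finite ι] (h : IsLaurentParam γ P M) (D : ℕ) :
    Module.finrank ℝ (MvPolynomial.restrictTotalDegree ι ℝ D) ≤ 2 * M * D + 1 +
      Module.finrank ℝ ↥(MvPolynomial.restrictTotalDegree ι ℝ D ⊓
        (RingHom.ker (MvPolynomial.aeval (R := ℝ) fun i => laurentFrac (P i) M)).restrictScalars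
          ℝ) := by
  obtain ⟨S, hS, hcard⟩ := exists_finset_subset_Ioc_card_eq (2 * M * D + 1)
  let ev : MvPolynomial.restrictTotalDegree ι ℝ D →ₗ[ℝ] S → ℝ :=
    LinearMap.pi fun θ => (MvPolynomial.aeval (γ θ)).toLinearMap ∘ₗ Submodule.subtype _
  have hker : (LinearMap.ker ev).map (Submodule.subtype _) ≤
      MvPolynomial.restrictTotalDegree ι ℝ D ⊓
        (RingHom.ker (MvPolynomial.aeval (R := ℝ) fun i => laurentFrac (P i) M)).restrictScalars
          ℝ := by
    rintro _ ⟨g, hg, rfl⟩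
    exact ⟨g.2, h.aeval_laurentFrac_eq_zero ((MvPolynomial.mem_restrictTotalDegree _ _ _).1 g.2)
      hS (by omega) fun θ hθ => congrFun (LinearMap.mem_ker.1 hg) ⟨θ, hθ⟩⟩
  calc _ = Module.finrank ℝ (LinearMap.range ev) + Module.finrank ℝ (LinearMap.ker ev) :=
        (LinearMap.finrank_range_add_finrank_ker ev).symm
    _ ≤ _ := by
        gcongr
        · simpa [hcard] using (LinearMap.range ev).finrank_le
        · rw [← Submodule.finrank_map_subtype_eq]
          exact Submodule.finrank_mono hker

end IsLaurentParam

theorem finrank_restrictTotalDegree_inf_span_singleton_le {ι K : Type*} [Finite ι] [Field K]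
    {f : MvPolynomial ι K} (hf : f ≠ 0) (D : ℕ) :
    Module.finrank K ↥(MvPolynomial.restrictTotalDegree ι K (D + f.totalDegree) ⊓
        (Ideal.span {f}).restrictScalars K) ≤
      Module.finrank K (MvPolynomial.restrictTotalDegree ι K D) := by
  refine (Submodule.finrank_mono ?_).trans (Submodule.finrank_map_le
    (LinearMap.mulLeft K f) (MvPolynomial.restrictTotalDegree ι K D))
  rintro g ⟨hgD, hgf⟩
  obtain ⟨q, rfl⟩ := Ideal.mem_span_singleton.1 hgf
  refine ⟨q, (MvPolynomial.mem_restrictTotalDegree _ _ _).2 ?_, rfl⟩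
  have hdeg := (MvPolynomial.mem_restrictTotalDegree _ _ _).1 hgD
  rcases eq_or_ne q 0 with rfl | hq
  · simp
  · rw [MvPolynomial.totalDegree_mul_of_isDomain hf hq] at hdeg
    omega

namespace IsLaurentParam

variable {γ : ℝ → Fin 2 → ℝ} {P : Fin 2 → ℂ[X]} {M : ℕ}

theorem ker_aeval_laurentFrac_ne_bot (h : IsLaurentParam γ P M) :
    RingHom.ker (MvPolynomial.aeval (R := ℝ) fun i => laurentFrac (P i) M) ≠ ⊥ := by
  intro hbot
  have hle := h.finrank_restrictTotalDegree_le (4 * M + 1)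
  have hdim := two_mul_finrank_restrictTotalDegree_fin_two ℝ (4 * M + 1)
  rw [hbot, Submodule.restrictScalars_bot, inf_bot_eq, finrank_bot, add_zero] at hle
  nlinarith

theorem totalDegree_le (h : IsLaurentParam γ P M) {f : MvPolynomial (Fin 2) ℝ} (hf : f ≠ 0)
    (hker : RingHom.ker (MvPolynomial.aeval (R := ℝ) fun i => laurentFrac (P i) M) =
      Ideal.span {f}) : f.totalDegree ≤ 2 * M := by
  by_contra! hlt
  obtain ⟨D, hD⟩ : ∃ D, D = 2 * M * f.totalDegree + 2 := ⟨_, rfl⟩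
  have hle := h.finrank_restrictTotalDegree_le (D + f.totalDegree)
  rw [hker] at hle
  have hspan := finrank_restrictTotalDegree_inf_span_singleton_le hf D
  have hdim := two_mul_finrank_restrictTotalDegree_fin_two ℝ D
  have hdim' := two_mul_finrank_restrictTotalDegree_fin_two ℝ (D + f.totalDegree)
  have hmul : (2 * M + 1) * D ≤ f.totalDegree * D := Nat.mul_le_mul_right D hlt
  nlinarith

end IsLaurentParam

section LaurentCurve

open ComplexConjugate

/-- The polynomial `X ^ n * conj H (1 / X)`, `n = deg H`, where `conj` acts on the coefficients. On
the unit circle, where `1 / z = conj z`, it interpolates the conjugate of `H`. -/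
noncomputable def conjReverse (H : ℂ[X]) : ℂ[X] :=
  H.reverse.map (starRingEnd ℂ)

theorem natDegree_conjReverse_le (H : ℂ[X]) : (conjReverse H).natDegree ≤ H.natDegree :=
  natDegree_map_le.trans (reverse_natDegree_le H)

theorem coeff_zero_conjReverse (H : ℂ[X]) : (conjReverse H).coeff 0 = conj H.leadingCoeff := by
  rw [conjReverse, coeff_map, coeff_zero_reverse]

theorem eval_conjReverse (H : ℂ[X]) (z : Circle) :
    (conjReverse H).eval (z : ℂ) = conj (H.eval (z : ℂ)) * (z : ℂ) ^ H.natDegree := by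
  have hz : conj (z : ℂ) * z = 1 := by
    rw [← Complex.normSq_eq_conj_mul_self, Circle.normSq_coe, Complex.ofReal_one]
  let _ : Invertible (conj (z : ℂ)) := ⟨z, by rw [mul_comm, hz], hz⟩
  have hrev := eval₂_reverse_mul_pow (starRingEnd ℂ) (conj (z : ℂ)) H
  rw [eval₂_at_apply] at hrev
  calc (conjReverse H).eval (z : ℂ)
      = (conjReverse H).eval (z : ℂ) * (conj (z : ℂ) * z) ^ H.natDegree := by
        rw [hz, one_pow, mul_one]
    _ = conj (H.eval (z : ℂ)) * (z : ℂ) ^ H.natDegree := by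
        rw [← hrev, mul_pow, ← mul_assoc, conjReverse, eval_map]
        rfl

/-- The image of the unit circle under `z ↦ H z / z ^ m`, as a curve in the real plane. -/
noncomputable def laurentCurve (H : ℂ[X]) (m : ℕ) (θ : ℝ) : Fin 2 → ℝ :=
  ![(H.eval (Circle.exp θ : ℂ) / (Circle.exp θ : ℂ) ^ m).re,
    (H.eval (Circle.exp θ : ℂ) / (Circle.exp θ : ℂ) ^ m).im]

/-- The numerators over `X ^ (m + 2)` of the coordinates of `laurentCurve H m`, that is, of the real
and imaginary parts of `H / X ^ m`, when `H` has degree `2 * m + 2`. -/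
noncomputable def coordNum (H : ℂ[X]) : Fin 2 → ℂ[X] :=
  ![C (1 / 2) * (H * X ^ 2 + conjReverse H), C (-Complex.I / 2) * (H * X ^ 2 - conjReverse H)]

theorem natDegree_coordNum {H : ℂ[X]} (hH : H ≠ 0) (i : Fin 2) :
    (coordNum H i).natDegree = H.natDegree + 2 := by
  have hX : (H * X ^ 2).natDegree = H.natDegree + 2 := natDegree_mul_X_pow 2 hH
  have hlt : (conjReverse H).natDegree < (H * X ^ 2).natDegree := by
    rw [hX]
    exact (natDegree_conjReverse_le H).trans_lt (by omega)
  fin_cases i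
  · exact (natDegree_C_mul (by norm_num)).trans
      ((natDegree_add_eq_left_of_natDegree_lt hlt).trans hX)
  · exact (natDegree_C_mul (by simp)).trans
      ((natDegree_sub_eq_left_of_natDegree_lt hlt).trans hX)

theorem coeff_zero_coordNum_ne_zero {H : ℂ[X]} (hH : H ≠ 0) (i : Fin 2) :
    (coordNum H i).coeff 0 ≠ 0 := by
  fin_cases i <;> simp [coordNum, mul_coeff_zero, coeff_zero_conjReverse, hH]

theorem eval_conjReverse_eq_conj_div {H : ℂ[X]} {m : ℕ} (hdeg : H.natDegree = 2 * m + 2)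
    (z : Circle) : (conjReverse H).eval (z : ℂ) =
      conj (H.eval (z : ℂ) / (z : ℂ) ^ m) * (z : ℂ) ^ (m + 2) := by
  rw [eval_conjReverse, hdeg, map_div₀, map_pow, ← Circle.coe_inv_eq_conj, Circle.coe_inv, inv_pow,
    div_inv_eq_mul]
  ring

theorem isLaurentParam_laurentCurve {H : ℂ[X]} {m : ℕ} (hdeg : H.natDegree = 2 * m + 2) :
    IsLaurentParam (laurentCurve H m) (coordNum H) (m + 2) where
  natDegree_le i := by
    rw [natDegree_coordNum (by rintro rfl; simp at hdeg), hdeg]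
    omega
  eval_eq i θ := by
    have hconj := eval_conjReverse_eq_conj_div hdeg (Circle.exp θ)
    simp only [laurentCurve]
    generalize Circle.exp θ = z at hconj ⊢
    have hH : H.eval (z : ℂ) = H.eval (z : ℂ) / (z : ℂ) ^ m * (z : ℂ) ^ m :=
      (div_mul_cancel₀ _ (pow_ne_zero _ z.coe_ne_zero)).symm
    generalize H.eval (z : ℂ) / (z : ℂ) ^ m = w at hconj hH ⊢
    fin_cases i
    · simp only [coordNum, Fin.zero_eta, Matrix.cons_val_zero, eval_mul, eval_add, eval_C, eval_pow,
        eval_X, hconj, hH, Complex.re_eq_add_conj]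
      ring
    · simp only [coordNum, Fin.mk_one, Matrix.cons_val_one, Matrix.cons_val_fin_one, eval_mul,
        eval_sub, eval_C, eval_pow, eval_X, hconj, hH, Complex.im_eq_sub_conj]
      field_simp
      linear_combination (conj w - w) * (z : ℂ) ^ (m + 2) * Complex.I_sq

theorem laurentFrac_coordNum_add_I_mul (H : ℂ[X]) (m : ℕ) :
    laurentFrac (coordNum H 0) (m + 2) +
      algebraMap ℂ (RatFunc ℂ) Complex.I * laurentFrac (coordNum H 1) (m + 2) =
        laurentFrac H m := by
  have hnum : coordNum H 0 + C Complex.I * coordNum H 1 = H * X ^ 2 := by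
    have hhalf : (C (1 / 2) : ℂ[X]) + C (1 / 2) = 1 := by
      rw [← C_add, add_halves, C_1]
    have hI : (C Complex.I : ℂ[X]) * C (-Complex.I / 2) = C (1 / 2) := by
      rw [← C_mul, ← mul_div_assoc, mul_neg, Complex.I_mul_I, neg_neg]
    simp only [coordNum, Matrix.cons_val_zero, Matrix.cons_val_one]
    linear_combination H * X ^ 2 * hhalf + (H * X ^ 2 - conjReverse H) * hI
  rw [laurentFrac, laurentFrac, laurentFrac, ← mul_div_assoc, ← add_div, RatFunc.algebraMap_eq_C,
    ← RatFunc.algebraMap_C, ← map_mul, ← map_add, hnum, map_mul, map_pow, RatFunc.algebraMap_X,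
    pow_add, mul_div_mul_right _ _ (pow_ne_zero 2 RatFunc.X_ne_zero)]

theorem finrank_adjoin_laurentFrac_coordNum {H : ℂ[X]} {m : ℕ} (hdeg : H.natDegree = 2 * m + 2)
    (i : Fin 2) : Module.finrank ℂ⟮laurentFrac (coordNum H i) (m + 2)⟯ (RatFunc ℂ) = 2 * m + 4 := by
  have hH : H ≠ 0 := by rintro rfl; simp at hdeg
  have hnum := natDegree_coordNum hH i
  rw [finrank_adjoin_laurentFrac (coeff_zero_coordNum_ne_zero hH i) (by omega), hnum, hdeg]

theorem transcendental_laurentFrac_coordNum {H : ℂ[X]} {m : ℕ} (hdeg : H.natDegree = 2 * m + 2)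
    (i : Fin 2) : Transcendental ℝ (laurentFrac (coordNum H i) (m + 2)) := fun halg =>
  transcendental_of_finrank_adjoin_ne_zero
    (by rw [finrank_adjoin_laurentFrac_coordNum hdeg]; omega) (halg.tower_top ℂ)

theorem adjoin_laurentFrac_coordNum_eq_top {H : ℂ[X]} {m : ℕ} (hm : 0 < m)
    (hdeg : H.natDegree = 2 * m + 2) (h0 : H.coeff 0 ≠ 0) (h1 : H.coeff (m + 1) ≠ 0) :
    adjoin ℂ (Set.range fun i => laurentFrac (coordNum H i) (m + 2)) = ⊤ := by
  set E := adjoin ℂ (Set.range fun i => laurentFrac (coordNum H i) (m + 2))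
  have hcoord : ∀ i, laurentFrac (coordNum H i) (m + 2) ∈ E := fun i =>
    subset_adjoin _ _ ⟨i, rfl⟩
  have hH : laurentFrac H m ∈ E := by
    rw [← laurentFrac_coordNum_add_I_mul]
    exact E.add_mem (hcoord 0) (E.mul_mem (E.algebraMap_mem _) (hcoord 1))
  have hdvd : Module.finrank E (RatFunc ℂ) ∣ 2 := by
    have hx := finrank_dvd_of_le_left (adjoin_simple_le_iff.2 (hcoord 0))
    have hw := finrank_dvd_of_le_left (adjoin_simple_le_iff.2 hH)
    rw [finrank_adjoin_laurentFrac_coordNum hdeg] at hx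
    rw [finrank_adjoin_laurentFrac h0 (by omega), hdeg] at hw
    simpa using Nat.dvd_sub hx hw
  have : CharZero E := charZero_of_injective_algebraMap (algebraMap ℂ E).injective
  have := isGalois_of_finrank_dvd_two hdvd
  exact eq_top_of_isGalois_of_laurentFrac_mem hm (by omega) h0 h1 E hH

theorem exists_isDefiningPolynomial_laurentCurve {H : ℂ[X]} {m : ℕ}
    (hdeg : H.natDegree = 2 * m + 2) :
    ∃ f, IsDefiningPolynomial f (laurentCurve H m '' Set.Icc (-Real.pi) Real.pi) := by
  have hparam := isLaurentParam_laurentCurve hdeg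
  have hprime := RingHom.ker_isPrime (MvPolynomial.aeval (R := ℝ) fun i =>
    laurentFrac (coordNum H i) (m + 2))
  have hdim : ringKrullDim (MvPolynomial (Fin 2) ℝ) ≤ 2 := by
    simp [MvPolynomial.ringKrullDim_of_isNoetherianRing]
  obtain ⟨f, hf, hspan⟩ := exists_irreducible_eq_span_singleton hdim
    hparam.ker_aeval_laurentFrac_ne_bot
    (not_isMaximal_ker_aeval (transcendental_laurentFrac_coordNum hdeg 0))
  exact ⟨f, hf, hparam.vanishingIdeal_eq_ker.trans hspan⟩

theorem IsDefiningPolynomial.degrees_laurentCurve {H : ℂ[X]} {m : ℕ} (hm : 0 < m)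
    (hdeg : H.natDegree = 2 * m + 2) (h0 : H.coeff 0 ≠ 0) (h1 : H.coeff (m + 1) ≠ 0)
    {f : MvPolynomial (Fin 2) ℝ}
    (hf : IsDefiningPolynomial f (laurentCurve H m '' Set.Icc (-Real.pi) Real.pi)) :
    f.totalDegree = 2 * m + 4 ∧ ∀ i, f.degreeOf i = 2 * m + 4 := by
  have hparam := isLaurentParam_laurentCurve hdeg
  have hker := hparam.vanishingIdeal_eq_ker.symm.trans hf.2
  have hfzero : MvPolynomial.aeval (fun i => laurentFrac (coordNum H i) (m + 2)) f = 0 := by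
    rw [← RingHom.mem_ker, hker]
    exact Ideal.mem_span_singleton_self f
  have hupper : f.totalDegree ≤ 2 * m + 4 := hparam.totalDegree_le hf.1.ne_zero hker
  have hlower : ∀ i, 2 * m + 4 ≤ f.degreeOf i := fun i => by
    obtain ⟨j, hij⟩ := exists_ne i
    have hfin := finrank_adjoin_laurentFrac_coordNum hdeg j
    have : FiniteDimensional ℂ⟮laurentFrac (coordNum H j) (m + 2)⟯ (RatFunc ℂ) :=
      FiniteDimensional.of_finrank_pos (by omega)
    rw [← hfin]
    exact finrank_adjoin_le_degreeOf (adjoin_laurentFrac_coordNum_eq_top hm hdeg h0 h1) hij.symm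
      (transcendental_laurentFrac_coordNum hdeg j) hf.1.ne_zero hfzero
  have hle := MvPolynomial.degreeOf_le_totalDegree f
  exact ⟨hupper.antisymm ((hlower 0).trans (hle 0)), fun i =>
    ((hle i).trans hupper).antisymm (hlower i)⟩

end LaurentCurve

section OddSupport

open ComplexConjugate

theorem hasDerivAt_oddSupport (α : ℝ) (N : ℕ) (a b : ℕ → ℝ) (θ : ℝ) :
    HasDerivAt (oddSupport α N a b) (∑ k ∈ Finset.range (N + 1), ((2 * k + 1 : ℕ) : ℝ) *
      (b (2 * k + 1) * Real.cos ((2 * k + 1 : ℕ) * θ) -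
        a (2 * k + 1) * Real.sin ((2 * k + 1 : ℕ) * θ))) θ := by
  refine HasDerivAt.const_add _ (HasDerivAt.fun_sum fun k _ => ?_)
  have hlin : HasDerivAt (fun θ : ℝ => ((2 * k + 1 : ℕ) : ℝ) * θ) ((2 * k + 1 : ℕ) : ℝ) θ := by
    simpa using (hasDerivAt_id θ).const_mul ((2 * k + 1 : ℕ) : ℝ)
  convert! (hlin.cos.const_mul (a (2 * k + 1))).add (hlin.sin.const_mul (b (2 * k + 1))) using 1
  ring

theorem param_oddSupport_zero (α : ℝ) (a b : ℕ → ℝ) (θ : ℝ) :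
    param (oddSupport α 0 a b) θ =
      ![a 1 + α / 2 * Real.cos θ, b 1 + α / 2 * Real.sin θ] := by
  rw [param, (hasDerivAt_oddSupport α 0 a b θ).deriv, oddSupport]
  simp only [zero_add, Finset.range_one, Finset.sum_singleton, mul_zero, Nat.cast_one, one_mul]
  congr 1
  · linear_combination a 1 * Real.cos_sq_add_sin_sq θ
  · congr 1
    linear_combination b 1 * Real.cos_sq_add_sin_sq θ

theorem exists_mem_Icc_eq_mul_cos_sin {r x y : ℝ} (hr : r ≠ 0) (h : x ^ 2 + y ^ 2 = r ^ 2) :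
    ∃ θ ∈ Set.Icc (-Real.pi) Real.pi, x = r * Real.cos θ ∧ y = r * Real.sin θ := by
  let z : ℂ := ⟨x / r, y / r⟩
  have hz : ‖z‖ = 1 := by
    rw [Complex.norm_def, Complex.normSq_apply, Real.sqrt_eq_one]
    change x / r * (x / r) + y / r * (y / r) = 1
    field_simp
    exact h
  refine ⟨z.arg, ⟨(Complex.neg_pi_lt_arg z).le, Complex.arg_le_pi z⟩, ?_, ?_⟩
  · have hcos := Complex.norm_mul_cos_arg z
    rw [hz, one_mul] at hcos
    rw [hcos, mul_div_cancel₀ _ hr]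
  · have hsin := Complex.norm_mul_sin_arg z
    rw [hz, one_mul] at hsin
    rw [hsin, mul_div_cancel₀ _ hr]

theorem isCircle_curve_oddSupport_zero {α : ℝ} (hα : α ≠ 0) (a b : ℕ → ℝ) :
    IsCircle (curve (oddSupport α 0 a b)) := by
  refine ⟨![a 1, b 1], |α / 2|, by positivity, Set.ext fun q => ⟨?_, fun hq => ?_⟩⟩
  · rintro ⟨θ, -, rfl⟩
    simp only [param_oddSupport_zero, Set.mem_ofPred_eq, Matrix.cons_val_zero, Matrix.cons_val_one,
      Matrix.cons_val_fin_one, add_sub_cancel_left, sq_abs]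
    linear_combination (α / 2) ^ 2 * Real.cos_sq_add_sin_sq θ
  · rw [Set.mem_ofPred_eq, sq_abs] at hq
    obtain ⟨θ, hθ, hx, hy⟩ := exists_mem_Icc_eq_mul_cos_sin (div_ne_zero hα two_ne_zero) hq
    refine ⟨θ, hθ, ?_⟩
    rw [param_oddSupport_zero, ← hx, ← hy]
    ext i
    fin_cases i <;> simp

/-- The coefficient of `exp ((2 * k + 1) * I * θ)` in the Fourier expansion of `oddSupport α N a b`,
for `k ≤ N`. -/
noncomputable def oddFourierCoeff (a b : ℕ → ℝ) (k : ℕ) : ℂ :=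
  ⟨a (2 * k + 1) / 2, -b (2 * k + 1) / 2⟩

theorem oddFourierCoeff_ne_zero {a b : ℕ → ℝ} {k : ℕ}
    (h : a (2 * k + 1) ≠ 0 ∨ b (2 * k + 1) ≠ 0) : oddFourierCoeff a b k ≠ 0 := by
  rw [Ne, Complex.ext_iff]
  simpa [oddFourierCoeff, imp_iff_not_or] using h

/-- With `p = oddSupport α N a b` and `z = exp (I * θ)`, the value of this polynomial at `z` is
`(p θ + I * p' θ) * z ^ (2 * N + 1)`. -/
noncomputable def supportNum (α : ℝ) (N : ℕ) (a b : ℕ → ℝ) : ℂ[X] :=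
  C ((α / 2 : ℝ) : ℂ) * X ^ (2 * N + 1) + ∑ k ∈ Finset.range (N + 1),
    (C (-(2 * k) * oddFourierCoeff a b k) * X ^ (2 * N + 2 + 2 * k) +
      C ((2 * k + 2) * conj (oddFourierCoeff a b k)) * X ^ (2 * N - 2 * k))

theorem natDegree_supportNum_le (α : ℝ) (N : ℕ) (a b : ℕ → ℝ) :
    (supportNum α N a b).natDegree ≤ 4 * N + 2 := by
  refine natDegree_add_le_of_degree_le ((natDegree_C_mul_X_pow_le _ _).trans (by omega))
    (natDegree_sum_le_of_forall_le _ _ fun k hk => ?_)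
  have hkN := Finset.mem_range.1 hk
  exact natDegree_add_le_of_degree_le ((natDegree_C_mul_X_pow_le _ _).trans (by omega))
    ((natDegree_C_mul_X_pow_le _ _).trans (by omega))

theorem coeff_supportNum (α : ℝ) (N : ℕ) (a b : ℕ → ℝ) (n : ℕ) :
    (supportNum α N a b).coeff n = (if n = 2 * N + 1 then ((α / 2 : ℝ) : ℂ) else 0) +
      ∑ k ∈ Finset.range (N + 1),
        ((if n = 2 * N + 2 + 2 * k then -(2 * k) * oddFourierCoeff a b k else 0) +
          if n = 2 * N - 2 * k then (2 * k + 2) * conj (oddFourierCoeff a b k) else 0) := by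
  simp only [supportNum, coeff_add, finsetSum_coeff, coeff_C_mul_X_pow]

theorem coeff_supportNum_middle (α : ℝ) (N : ℕ) (a b : ℕ → ℝ) :
    (supportNum α N a b).coeff (2 * N + 1) = ((α / 2 : ℝ) : ℂ) := by
  rw [coeff_supportNum, if_pos rfl, Finset.sum_eq_zero, add_zero]
  intro k _
  rw [if_neg (by omega), if_neg (by omega), add_zero]

theorem coeff_supportNum_top (α : ℝ) (N : ℕ) (a b : ℕ → ℝ) :
    (supportNum α N a b).coeff (4 * N + 2) = -(2 * N) * oddFourierCoeff a b N := by
  rw [coeff_supportNum, if_neg (by omega), zero_add, Finset.sum_eq_single N]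
  · rw [if_pos (by omega), if_neg (by omega), add_zero]
  · intro k _ hk
    rw [if_neg (by omega), if_neg (by omega), add_zero]
  · simp

theorem coeff_supportNum_zero (α : ℝ) (N : ℕ) (a b : ℕ → ℝ) :
    (supportNum α N a b).coeff 0 = (2 * N + 2) * conj (oddFourierCoeff a b N) := by
  rw [coeff_supportNum, if_neg (by omega), zero_add, Finset.sum_eq_single N]
  · rw [if_neg (by omega), if_pos (by omega), zero_add]
  · intro k hk hkN
    have := Finset.mem_range.1 hk
    rw [if_neg (by omega), if_neg (by omega), add_zero]
  · simp

theorem natDegree_supportNum (α : ℝ) {N : ℕ} {a b : ℕ → ℝ} (hN : N ≠ 0)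
    (htop : a (2 * N + 1) ≠ 0 ∨ b (2 * N + 1) ≠ 0) :
    (supportNum α N a b).natDegree = 4 * N + 2 := by
  refine (natDegree_supportNum_le α N a b).antisymm (le_natDegree_of_ne_zero ?_)
  simpa [coeff_supportNum_top, hN] using oddFourierCoeff_ne_zero htop

theorem coeff_zero_supportNum_ne_zero (α : ℝ) {N : ℕ} {a b : ℕ → ℝ}
    (htop : a (2 * N + 1) ≠ 0 ∨ b (2 * N + 1) ≠ 0) : (supportNum α N a b).coeff 0 ≠ 0 := by
  rw [coeff_supportNum_zero]
  refine mul_ne_zero ?_ ((_root_.map_ne_zero _).2 (oddFourierCoeff_ne_zero htop))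
  exact_mod_cast (2 * N + 1).succ_ne_zero

theorem oddFourierCoeff_mul_add_conj_mul (a b : ℕ → ℝ) (k : ℕ) (z : ℂ) :
    -(2 * k) * oddFourierCoeff a b k * z + (2 * k + 2) * conj (oddFourierCoeff a b k) * conj z =
      (a (2 * k + 1) * z.re + b (2 * k + 1) * z.im : ℝ) +
        ((2 * k + 1 : ℕ) * (b (2 * k + 1) * z.re - a (2 * k + 1) * z.im) : ℝ) * Complex.I := by
  apply Complex.ext <;> simp [oddFourierCoeff] <;> ring

theorem pow_two_mul_sub_eq_conj_mul {k N : ℕ} (hk : k ≤ N) (z : Circle) :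
    (z : ℂ) ^ (2 * N - 2 * k) = conj ((z : ℂ) ^ (2 * k + 1)) * (z : ℂ) ^ (2 * N + 1) := by
  have hinv : conj ((z : ℂ) ^ (2 * k + 1)) * (z : ℂ) ^ (2 * k + 1) = 1 := by
    rw [← Circle.coe_pow, ← Circle.coe_inv_eq_conj, ← Circle.coe_mul, inv_mul_cancel,
      Circle.coe_one]
  have hsplit : 2 * N + 1 = 2 * k + 1 + (2 * N - 2 * k) := by omega
  rw [hsplit, pow_add _ (2 * k + 1), ← mul_assoc, hinv, one_mul]

theorem oddFourierCoeff_mul_exp_pow_add (a b : ℕ → ℝ) {k N : ℕ} (hk : k ≤ N) (θ : ℝ) :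
    -(2 * k) * oddFourierCoeff a b k * (Circle.exp θ : ℂ) ^ (2 * N + 2 + 2 * k) +
        (2 * k + 2) * conj (oddFourierCoeff a b k) * (Circle.exp θ : ℂ) ^ (2 * N - 2 * k) =
      ((a (2 * k + 1) * Real.cos ((2 * k + 1 : ℕ) * θ) +
          b (2 * k + 1) * Real.sin ((2 * k + 1 : ℕ) * θ) : ℝ) +
        ((2 * k + 1 : ℕ) * (b (2 * k + 1) * Real.cos ((2 * k + 1 : ℕ) * θ) -
          a (2 * k + 1) * Real.sin ((2 * k + 1 : ℕ) * θ)) : ℝ) * Complex.I) *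
        (Circle.exp θ : ℂ) ^ (2 * N + 1) := by
  have hpow : (Circle.exp θ : ℂ) ^ (2 * k + 1) =
      Complex.exp (((2 * k + 1 : ℕ) * θ : ℝ) * Complex.I) := by
    rw [← Circle.coe_exp, Circle.exp_natCast_mul, Circle.coe_pow]
  have hup : (Circle.exp θ : ℂ) ^ (2 * N + 2 + 2 * k) =
      (Circle.exp θ : ℂ) ^ (2 * k + 1) * (Circle.exp θ : ℂ) ^ (2 * N + 1) := by
    rw [← pow_add]
    congr 1
    omega
  rw [← Complex.exp_ofReal_mul_I_re, ← Complex.exp_ofReal_mul_I_im, ← hpow,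
    ← oddFourierCoeff_mul_add_conj_mul, pow_two_mul_sub_eq_conj_mul hk, hup]
  ring

theorem eval_supportNum (α : ℝ) (N : ℕ) (a b : ℕ → ℝ) (θ : ℝ) :
    (supportNum α N a b).eval (Circle.exp θ : ℂ) =
      (oddSupport α N a b θ + deriv (oddSupport α N a b) θ * Complex.I) *
        (Circle.exp θ : ℂ) ^ (2 * N + 1) := by
  rw [(hasDerivAt_oddSupport α N a b θ).deriv, oddSupport, supportNum]
  simp only [eval_add, eval_mul, eval_C, eval_pow, eval_X, eval_finsetSum]
  rw [Finset.sum_congr rfl fun k hk =>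
    oddFourierCoeff_mul_exp_pow_add a b (Finset.mem_range_succ_iff.1 hk) θ, ← Finset.sum_mul,
    ← add_mul, Finset.sum_add_distrib, ← Finset.sum_mul, Complex.ofReal_add, Complex.ofReal_sum,
    Complex.ofReal_sum, add_assoc]

theorem param_oddSupport_eq_laurentCurve (α : ℝ) (N : ℕ) (a b : ℕ → ℝ) :
    param (oddSupport α N a b) = laurentCurve (supportNum α N a b) (2 * N) := by
  ext θ i
  have heval : (supportNum α N a b).eval (Circle.exp θ : ℂ) / (Circle.exp θ : ℂ) ^ (2 * N) =
      (oddSupport α N a b θ + deriv (oddSupport α N a b) θ * Complex.I) *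
        (Real.cos θ + Real.sin θ * Complex.I) := by
    rw [eval_supportNum, pow_succ', ← mul_assoc,
      mul_div_cancel_right₀ _ (pow_ne_zero _ (Circle.coe_ne_zero _)), Circle.coe_exp,
      Complex.exp_mul_I, Complex.ofReal_cos, Complex.ofReal_sin]
  rw [laurentCurve, heval, param]
  congr 2 <;> simp [Complex.cos_ofReal_re, Complex.sin_ofReal_re]

end OddSupport

end ConstantWidth

theorem theorem2p2_general (α : ℝ) (N : ℕ) (a b : ℕ → ℝ) (hα : α ≠ 0)
    (hcirc : ¬ ConstantWidth.IsCircle (ConstantWidth.curve (ConstantWidth.oddSupport α N a b)))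
    (htop : a (2 * N + 1) ≠ 0 ∨ b (2 * N + 1) ≠ 0) :
    (∃ f : MvPolynomial (Fin 2) ℝ, ConstantWidth.IsDefiningPolynomial f
      (ConstantWidth.curve (ConstantWidth.oddSupport α N a b))) ∧
    ∀ f : MvPolynomial (Fin 2) ℝ, ConstantWidth.IsDefiningPolynomial f
        (ConstantWidth.curve (ConstantWidth.oddSupport α N a b)) →
      f.totalDegree = 4 * N + 4 ∧
      MvPolynomial.degreeOf 0 f = 4 * N + 4 ∧
      MvPolynomial.degreeOf 1 f = 4 * N + 4 := by
  have hN : N ≠ 0 := by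
    rintro rfl
    exact hcirc (ConstantWidth.isCircle_curve_oddSupport_zero hα a b)
  have hdeg : (ConstantWidth.supportNum α N a b).natDegree = 2 * (2 * N) + 2 :=
    (ConstantWidth.natDegree_supportNum α hN htop).trans (by ring)
  have hmid : (ConstantWidth.supportNum α N a b).coeff (2 * N + 1) ≠ 0 := by
    rw [ConstantWidth.coeff_supportNum_middle]
    exact_mod_cast div_ne_zero hα two_ne_zero
  rw [ConstantWidth.curve, ConstantWidth.param_oddSupport_eq_laurentCurve]
  refine ⟨ConstantWidth.exists_isDefiningPolynomial_laurentCurve hdeg, fun f hf => ?_⟩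
  obtain ⟨htotal, hpartial⟩ := hf.degrees_laurentCurve (by omega) hdeg
    (ConstantWidth.coeff_zero_supportNum_ne_zero α htop) hmid
  have heq : 2 * (2 * N) + 4 = 4 * N + 4 := by ring
  exact heq ▸ ⟨htotal, hpartial 0, hpartial 1⟩

theorem theorem2p2 (C : Set (Fin 2 → ℝ)) (α : ℝ) (N : ℕ) (a b : ℕ → ℝ)
    (hC : ConstantWidth.IsConstantWidthCurve C α N a b)
    (hcirc : ¬ ConstantWidth.IsCircle C)
    (htop : a (2 * N + 1) ≠ 0 ∨ b (2 * N + 1) ≠ 0) :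
    (∃ f : MvPolynomial (Fin 2) ℝ, ConstantWidth.IsDefiningPolynomial f C) ∧
    ∀ f : MvPolynomial (Fin 2) ℝ, ConstantWidth.IsDefiningPolynomial f C →
      f.totalDegree = 4 * N + 4 ∧
      MvPolynomial.degreeOf 0 f = 4 * N + 4 ∧
      MvPolynomial.degreeOf 1 f = 4 * N + 4 := by
  obtain ⟨hα, rfl, -⟩ := hC
  exact theorem2p2_general α N a b hα.ne' hcirc htop
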